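/- Consider $\lambda$-terms in de Bruijn notation, i.e. the objects generated by the grammar $M ::= \underline{k} \mid M\,M \mid \lambda M$ with $k\in\{0,1,2,\dots\}$ (plain terms: no restriction is put on the indices). Plain closures $\mathfrak c$ and plain environments $e$ are defined by mutual recursion: a closure is a pair $\langle M, e\rangle$ of a plain term $M$ and an environment $e$, and an environment is a finite list of closures, $e ::= \Box \mid \mathfrak c : e$. Sizes are given by $$|\underline{k}| = k+1,\quad |M\,N| = |M|+|N|+1,\quad |\lambda M| = |M|+1,\quad |\langle M,e\rangle| = |M|+|e|,\quad |\mathfrak c : e| = |\mathfrak c|+|e|,\quad |\Box| = 0 .$$ Let $l_n$, $e_n$ and $c_n$ be the numbers (all finite) of plain terms, plain environments and plain closures of size $n$, respectively, and let $L_\infty(z)=\sum_{n\ge 0} l_n z^n$. **Theorem.** As $n\to\infty$, $$e_n \sim C_e\,\rho^{-n} n^{-3/2} \qquad\text{and}\qquad c_n \sim C_c\,\rho^{-n} n^{-3/2},$$ where $$\rho = \frac{1}{10}\left(25-\sqrt{545}\right) \doteq 0.165476, \qquad \rho^{-1} \doteq 6.04315,$$ $$C_e = \frac{\sqrt{\frac{5}{47}\left(109+35\sqrt{545}\right)}}{8\sqrt{\pi}}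 \doteq 0.699997, \qquad C_c = \frac{\sqrt{\frac{10\left(48069\sqrt5-10295\sqrt{109}\right)}{65\sqrt{109}-301\sqrt5}}}{\sqrt{\pi}\,\left(77-3\sqrt{545}\right)} \doteq 0.174999,$$ and $\doteq$ means that the two numbers differ by less than half a unit of the last displayed decimal. Moreover, $\rho$ is the unique complex number $z$ at which the power series $L_\infty(z)$ converges absolutely and $1-4L_\infty(z)=0$. -/

import Mathlib

namespace PlainClosures

/-- Plain lambda-terms in de Bruijn notation: de Bruijn indices, applications and abstractions,
with no restriction on the indices. -/
inductive Term : Type where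
  | idx : ℕ → Term
  | app : Term → Term → Term
  | lam : Term → Term

/-- The natural size of a plain lambda-term. An index is written in unary with a successor and
a zero, each of weight one, so the index `n` has size `n + 1`. -/
def Term.size : Term → ℕ
  | .idx n => n + 1
  | .app M N => M.size + N.size + 1
  | .lam M => M.size + 1

mutual
  /-- A closure couples a plain lambda-term with an environment. -/
  inductive Clos : Type where
    | mk : Term → Env → Clos
  /-- An environment is a finite list of closures. -/
  inductive Env : Type where
    | nil : Env
    | cons : Clos → Env → Env
end

mutual
  /-- The size of a closure: the constructors of closures and environments have weight zero. -/
  def Clos.size : Clos → ℕ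
    | .mk M e => M.size + e.size
  /-- The size of an environment. -/
  def Env.size : Env → ℕ
    | .nil => 0
    | .cons c e => c.size + e.size
end

/-- The set of plain lambda-terms of size `n`. -/
def termsOfSize (n : ℕ) : Set Term := {M | M.size = n}

/-- The set of plain environments of size `n`. -/
def envsOfSize (n : ℕ) : Set Env := {e | e.size = n}

/-- The set of plain closures of size `n`. -/
def closuresOfSize (n : ℕ) : Set Clos := {c | c.size = n}

/-- The number of plain lambda-terms of size `n`. -/
noncomputable def termCount (n : ℕ) : ℕ := (termsOfSize n).ncard

/-- The number of plain environments of size `n`. -/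
noncomputable def envCount (n : ℕ) : ℕ := (envsOfSize n).ncard

/-- The number of plain closures of size `n`. -/
noncomputable def closureCount (n : ℕ) : ℕ := (closuresOfSize n).ncard

/-- The generating function of plain lambda-terms, meaningful at the points `z` where the
power series is summable. -/
noncomputable def termGF (z : ℂ) : ℂ := ∑' n : ℕ, (termCount n : ℂ) * z ^ n

/-- The number `(25 - √545) / 10`. -/
noncomputable def rho : ℝ := (1 / 10) * (25 - √545)

/-- The constant for environments. -/
noncomputable def constEnv : ℝ := √((5 / 47) * (109 + 35 * √545)) / (8 * √Real.pi)

/-- The constant for closures. -/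
noncomputable def constClos : ℝ :=
  √((10 * (48069 * √5 - 10295 * √109)) / (65 * √109 - 301 * √5)) /
    (√Real.pi * (77 - 3 * √545))

end PlainClosures

/-!
The generating series `L`, `E`, `C` of terms, environments and closures satisfy
`L = X / (1 - X) + X L + X L ^ 2`, `C = L E` and `E = 1 + C E`, so that `1 - 2 C` is a square root
of `1 - 4 L` (`one_sub_two_closSeries_sq`). The series `L` converges beyond `rho` and
`L(rho) = 1/4`, so `1 - 4 L` has a simple zero at `rho`, where `C` has a square-root singularity.

The singularity analysis uses formal power series and absolute convergence on the real line
only. Factor `1 - 2 C = G √(1 - X / rho)`, with `G` the `regularFactor`. The coefficients of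
`G ^ 2 = (1 - 4 L) / (1 - X / rho)` are nonnegative, being tails of the series `4 L(rho) = 1` up to
powers of `rho`, and the sum of `G ^ 2` at `1/5 > rho` is at most `2`. This forces `G` itself to
converge absolutely at `1/5` (`absSummableAt_of_sq`): its nonconstant part is majorized by a
solution of a quadratic equation.
By Bender's theorem on convolutions (`tendsto_coeff_mul_div`) the coefficients of `1 - 2 C` are then
`G(rho)` times those of `√(1 - X / rho)`, whose size is given by Euler's limit for `Γ(-1/2)`
(`tendsto_coeff_sqrtSeries`). The conjugate of `1 - 4 L` gives
`G ^ 2 = (4 - 5 rho X) / ((1 - X) (4 - 5 X - 4 X L))`, hence the value of `G(rho)`.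

Environments follow by a second application of Bender's theorem to `X E = C (X / L)`, because
`X / L` is a polynomial in `X` and `L`.
-/

namespace PlainClosures

open PowerSeries Finset Filter Topology

/-! ### Counting pairs by the sum of two weights -/

/-- If `f` and `g` have finite fibres, so has `(a, b) ↦ f a + g b`, and its fibres are counted by
the Cauchy product of the two counting sequences. -/
theorem finite_and_ncard_pairs {α β : Type*} (f : α → ℕ) (g : β → ℕ)
    (hf : ∀ n, {a | f a = n}.Finite) (hg : ∀ n, {b | g b = n}.Finite) (n : ℕ) :
    {p : α × β | f p.1 + g p.2 = n}.Finite ∧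
      {p : α × β | f p.1 + g p.2 = n}.ncard =
        ∑ q ∈ antidiagonal n, {a | f a = q.1}.ncard * {b | g b = q.2}.ncard := by
  classical
  have hfin : {p : α × β | f p.1 + g p.2 = n}.Finite := by
    have : {p : α × β | f p.1 + g p.2 = n} =
        ⋃ q ∈ antidiagonal n, {a | f a = q.1} ×ˢ {b | g b = q.2} := by
      ext p
      simp
    rw [this]
    exact (antidiagonal n).finite_toSet.biUnion fun q _ => (hf q.1).prod (hg q.2)
  refine ⟨hfin, ?_⟩
  rw [Set.ncard_eq_toFinset_card _ hfin,
    card_eq_sum_card_fiberwise (f := fun p : α × β => (f p.1, g p.2)) (t := antidiagonal n)]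
  · refine sum_congr rfl fun q hq => ?_
    rw [← Set.ncard_prod, ← Set.ncard_coe_finset]
    congr 1
    ext p
    have := mem_antidiagonal.1 hq
    simp only [coe_filter, Set.Finite.mem_toFinset, Set.mem_ofPred_eq, Set.mem_prod, Prod.ext_iff]
    constructor
    · exact fun h => h.2
    · rintro ⟨h1, h2⟩
      exact ⟨by rw [h1, h2, this], h1, h2⟩
  · intro p hp
    simpa using hp

/-! ### Finiteness and recurrences for the counting sequences -/

theorem termsOfSize_zero : termsOfSize 0 = ∅ := by
  ext M
  cases M <;> simp [termsOfSize, Term.size]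

theorem termsOfSize_succ (n : ℕ) :
    termsOfSize (n + 1) = insert (Term.idx n) (Term.lam '' termsOfSize n ∪
      (fun p : Term × Term => Term.app p.1 p.2) '' {p | p.1.size + p.2.size = n}) := by
  ext M
  cases M <;> simp [termsOfSize, Term.size]

theorem Term.size_pos (M : Term) : 0 < M.size := by
  cases M <;> simp [Term.size]

theorem termsOfSize_finite (n : ℕ) : (termsOfSize n).Finite := by
  induction n using Nat.strong_induction_on with
  | _ n ih =>
    cases n with
    | zero => simp [termsOfSize_zero]
    | succ n =>
      have hlt : {M : Term | M.size < n + 1}.Finite := by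
        have : {M : Term | M.size < n + 1} = ⋃ i ∈ range (n + 1), termsOfSize i := by
          ext M
          simp [termsOfSize]
        rw [this]
        exact (range (n + 1)).finite_toSet.biUnion fun i hi => ih i (by simpa using hi)
      rw [termsOfSize_succ]
      refine (((ih n n.lt_succ_self).image _).union (Set.Finite.image _ ?_)).insert _
      refine (hlt.prod hlt).subset ?_
      rintro ⟨M, N⟩ h
      simp only [Set.mem_ofPred_eq, Set.mem_prod] at h ⊢
      omega

theorem termCount_zero : termCount 0 = 0 := by
  simp [termCount, termsOfSize_zero]

theorem termCount_succ (n : ℕ) :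
    termCount (n + 1) =
      1 + termCount n + ∑ q ∈ antidiagonal n, termCount q.1 * termCount q.2 := by
  obtain ⟨hfin, hcard⟩ := finite_and_ncard_pairs Term.size Term.size
    termsOfSize_finite termsOfSize_finite n
  have hlam : (Term.lam '' termsOfSize n).Finite := (termsOfSize_finite n).image _
  have hdisj : Disjoint (Term.lam '' termsOfSize n)
      ((fun p : Term × Term => Term.app p.1 p.2) '' {p | p.1.size + p.2.size = n}) := by
    rw [Set.disjoint_left]
    rintro _ ⟨M, _, rfl⟩ ⟨p, _, hp⟩
    cases hp
  have hinj : Function.Injective fun p : Term × Term => Term.app p.1 p.2 := by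
    rintro ⟨M, N⟩ ⟨M', N'⟩ h
    simpa using h
  rw [termCount, termsOfSize_succ, Set.ncard_insert_of_notMem (by simp) (hlam.union (hfin.image _)),
    Set.ncard_union_eq hdisj hlam (hfin.image _),
    Set.ncard_image_of_injective _ (fun _ _ h => by simpa using h),
    Set.ncard_image_of_injective _ hinj, hcard]
  simp only [termCount, termsOfSize]
  ring

theorem envsOfSize_finite (n : ℕ) : (envsOfSize n).Finite := by
  induction n using Nat.strong_induction_on with
  | _ n ih =>
    have hlt : {e : Env | e.size < n}.Finite := by
      have : {e : Env | e.size < n} = ⋃ i ∈ range n, envsOfSize i := by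
        ext M
        simp [envsOfSize]
      rw [this]
      exact (range n).finite_toSet.biUnion fun i hi => ih i (by simpa using hi)
    have hterm : {M : Term | M.size < n + 1}.Finite := by
      have : {M : Term | M.size < n + 1} = ⋃ i ∈ range (n + 1), termsOfSize i := by
        ext M
        simp [termsOfSize]
      rw [this]
      exact (range (n + 1)).finite_toSet.biUnion fun i _ => termsOfSize_finite i
    refine (((hterm.prod (hlt.prod hlt)).image
      fun p => Env.cons (Clos.mk p.1 p.2.1) p.2.2).insert Env.nil).subset ?_
    intro e he
    rcases e with _ | ⟨⟨M, e₁⟩, e₂⟩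
    · simp
    · have := M.size_pos
      simp only [envsOfSize, Set.mem_ofPred_eq, Env.size, Clos.size] at he
      refine Or.inr ⟨(M, e₁, e₂), ?_, rfl⟩
      simp only [Set.mem_prod, Set.mem_ofPred_eq]
      omega

theorem closuresOfSize_eq_image (n : ℕ) :
    closuresOfSize n =
      (fun p : Term × Env => Clos.mk p.1 p.2) '' {p | p.1.size + p.2.size = n} := by
  ext c
  cases c
  simp [closuresOfSize, Clos.size]

theorem closuresOfSize_finite (n : ℕ) : (closuresOfSize n).Finite := by
  rw [closuresOfSize_eq_image]
  exact (finite_and_ncard_pairs Term.size Env.size termsOfSize_finite envsOfSize_finite n).1.image _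

theorem closureCount_eq (n : ℕ) :
    closureCount n = ∑ q ∈ antidiagonal n, termCount q.1 * envCount q.2 := by
  have hinj : Function.Injective fun p : Term × Env => Clos.mk p.1 p.2 := by
    rintro ⟨M, N⟩ ⟨M', N'⟩ h
    simpa using h
  rw [closureCount, closuresOfSize_eq_image, Set.ncard_image_of_injective _ hinj,
    (finite_and_ncard_pairs Term.size Env.size termsOfSize_finite envsOfSize_finite n).2]
  rfl

theorem envCount_eq (n : ℕ) :
    envCount n =
      (if n = 0 then 1 else 0) + ∑ q ∈ antidiagonal n, closureCount q.1 * envCount q.2 := by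
  obtain ⟨hfin, hcard⟩ := finite_and_ncard_pairs Clos.size Env.size
    closuresOfSize_finite envsOfSize_finite n
  have hinj : Function.Injective fun p : Clos × Env => Env.cons p.1 p.2 := by
    rintro ⟨M, N⟩ ⟨M', N'⟩ h
    simpa using h
  have hset : envsOfSize n = {e | e = Env.nil ∧ n = 0} ∪
      (fun p : Clos × Env => Env.cons p.1 p.2) '' {p | p.1.size + p.2.size = n} := by
    ext e
    cases e <;> simp [envsOfSize, Env.size, eq_comm]
  have hdisj : Disjoint {e | e = Env.nil ∧ n = 0}
      ((fun p : Clos × Env => Env.cons p.1 p.2) '' {p | p.1.size + p.2.size = n}) := by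
    rw [Set.disjoint_left]
    rintro _ ⟨rfl, _⟩ ⟨p, _, hp⟩
    cases hp
  have hnil : {e | e = Env.nil ∧ n = 0}.Finite :=
    (Set.finite_singleton Env.nil).subset fun e he => he.1
  rw [envCount, hset, Set.ncard_union_eq hdisj hnil (hfin.image _),
    Set.ncard_image_of_injective _ hinj, hcard]
  congr 1
  split_ifs with h <;> simp [h]

/-! ### Generating series -/

/-- The generating series of plain terms. -/
noncomputable def termSeries : ℝ⟦X⟧ := PowerSeries.mk fun n => (termCount n : ℝ)

/-- The generating series of plain environments. -/
noncomputable def envSeries : ℝ⟦X⟧ := PowerSeries.mk fun n => (envCount n : ℝ)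

/-- The generating series of plain closures. -/
noncomputable def closSeries : ℝ⟦X⟧ := PowerSeries.mk fun n => (closureCount n : ℝ)

/-- The functional equation of the generating series of plain terms, cleared of the
denominator `1 - X` that comes from the indices. -/
theorem termSeries_eq :
    (1 - X) * termSeries = X + X * (1 - X) * (termSeries + termSeries ^ 2) := by
  have h : termSeries = X * (PowerSeries.mk 1 + termSeries + termSeries ^ 2) := by
    ext n
    cases n with
    | zero => simp [termSeries, termCount_zero]
    | succ n =>
      rw [coeff_succ_X_mul, sq]
      simp only [map_add, coeff_mul, termSeries, coeff_mk, termCount_succ]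
      push_cast
      simp
  have h1 := PowerSeries.mk_one_mul_one_sub_eq_one ℝ
  linear_combination (1 - X) * h + X * h1

theorem closSeries_eq : closSeries = termSeries * envSeries := by
  ext n
  simp [coeff_mul, termSeries, envSeries, closSeries, closureCount_eq]

theorem envSeries_eq : envSeries = 1 + closSeries * envSeries := by
  ext n
  simp only [map_add, coeff_mul, closSeries, envSeries, coeff_mk, coeff_one]
  conv_lhs => rw [envCount_eq]
  push_cast
  rfl

/-- Solving the quadratic equation for closures: `1 - 2 C` is a square root of `1 - 4 L`. -/
theorem one_sub_two_closSeries_sq : (1 - 2 * closSeries) ^ 2 = 1 - 4 * termSeries := by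
  have h : closSeries * (1 - closSeries) = termSeries := by
    linear_combination (1 - closSeries) * closSeries_eq + termSeries * envSeries_eq
  linear_combination -4 * h

theorem one_le_termCount_succ (n : ℕ) : 1 ≤ termCount (n + 1) := by
  rw [termCount_succ]
  omega

theorem closureCount_zero : closureCount 0 = 0 := by
  simp [closureCount_eq, termCount_zero]

theorem envCount_zero : envCount 0 = 1 := by
  rw [envCount_eq]
  simp [closureCount_zero]

theorem closureCount_succ_pos (n : ℕ) : 0 < closureCount (n + 1) := by
  rw [closureCount_eq]
  refine sum_pos' (fun _ _ => Nat.zero_le _) ⟨(n + 1, 0), by simp, ?_⟩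
  have := one_le_termCount_succ n
  simp only [envCount_zero, mul_one]
  omega

/-! ### Absolutely convergent power series -/

/-- The power series `f` converges absolutely at `x`. -/
def AbsSummableAt {𝕜 : Type*} [NormedField 𝕜] (f : 𝕜⟦X⟧) (x : 𝕜) : Prop :=
  Summable fun n => ‖coeff n f * x ^ n‖

/-- The sum of the power series `f` at `x`, meaningful where the series is summable. -/
noncomputable def evalAt {𝕜 : Type*} [NormedField 𝕜] (f : 𝕜⟦X⟧) (x : 𝕜) : 𝕜 :=
  ∑' n, coeff n f * x ^ n

section Eval

variable {𝕜 : Type*} [NormedField 𝕜] {f g : 𝕜⟦X⟧} {x : 𝕜}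

theorem coeff_mul_mul_pow (f g : 𝕜⟦X⟧) (x : 𝕜) (n : ℕ) :
    coeff n (f * g) * x ^ n =
      ∑ p ∈ antidiagonal n, (coeff p.1 f * x ^ p.1) * (coeff p.2 g * x ^ p.2) := by
  rw [coeff_mul, sum_mul]
  refine sum_congr rfl fun p hp => ?_
  rw [← mem_antidiagonal.1 hp, pow_add]
  ring

theorem AbsSummableAt.mul (hf : AbsSummableAt f x) (hg : AbsSummableAt g x) :
    AbsSummableAt (f * g) x := by
  simpa only [AbsSummableAt, coeff_mul_mul_pow] using
    summable_norm_sum_mul_antidiagonal_of_summable_norm hf hg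

theorem AbsSummableAt.sub (hf : AbsSummableAt f x) (hg : AbsSummableAt g x) :
    AbsSummableAt (f - g) x := by
  refine Summable.of_nonneg_of_le (fun _ => norm_nonneg _) (fun n => ?_) (Summable.add hf hg)
  rw [map_sub, sub_mul]
  exact norm_sub_le _ _

theorem AbsSummableAt.add (hf : AbsSummableAt f x) (hg : AbsSummableAt g x) :
    AbsSummableAt (f + g) x := by
  refine Summable.of_nonneg_of_le (fun _ => norm_nonneg _) (fun n => ?_) (Summable.add hf hg)
  rw [map_add, add_mul]
  exact norm_add_le _ _

theorem absSummableAt_C (a x : 𝕜) : AbsSummableAt (C a) x :=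
  summable_of_ne_finset_zero (s := {0}) fun n hn => by
    have : n ≠ 0 := by simpa using hn
    simp [coeff_C, this]

theorem absSummableAt_X (x : 𝕜) : AbsSummableAt (X : 𝕜⟦X⟧) x :=
  summable_of_ne_finset_zero (s := {1}) fun n hn => by
    have : n ≠ 1 := by simpa using hn
    simp [coeff_X, this]

theorem absSummableAt_one (x : 𝕜) : AbsSummableAt (1 : 𝕜⟦X⟧) x := by
  simpa using absSummableAt_C (1 : 𝕜) x

theorem evalAt_C (a x : 𝕜) : evalAt (C a) x = a := by
  rw [evalAt, tsum_eq_single 0 fun n hn => by simp [coeff_C, hn]]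
  simp

theorem evalAt_one (x : 𝕜) : evalAt (1 : 𝕜⟦X⟧) x = 1 := by
  simpa using evalAt_C (1 : 𝕜) x

theorem evalAt_X (x : 𝕜) : evalAt (X : 𝕜⟦X⟧) x = x := by
  rw [evalAt, tsum_eq_single 1 fun n hn => by simp [coeff_X, hn]]
  simp

variable [CompleteSpace 𝕜]

theorem evalAt_mul (hf : AbsSummableAt f x) (hg : AbsSummableAt g x) :
    evalAt (f * g) x = evalAt f x * evalAt g x := by
  simp only [evalAt, coeff_mul_mul_pow]
  exact (tsum_mul_tsum_eq_tsum_sum_antidiagonal_of_summable_norm hf hg).symm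

theorem evalAt_sub (hf : AbsSummableAt f x) (hg : AbsSummableAt g x) :
    evalAt (f - g) x = evalAt f x - evalAt g x := by
  simp only [evalAt, map_sub, sub_mul]
  exact (Summable.of_norm hf).tsum_sub (Summable.of_norm hg)

theorem evalAt_add (hf : AbsSummableAt f x) (hg : AbsSummableAt g x) :
    evalAt (f + g) x = evalAt f x + evalAt g x := by
  simp only [evalAt, map_add, add_mul]
  exact (Summable.of_norm hf).tsum_add (Summable.of_norm hg)

end Eval

theorem AbsSummableAt.of_le {f : ℝ⟦X⟧} {s r : ℝ} (hf : AbsSummableAt f r) (hs : 0 ≤ s)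
    (hsr : s ≤ r) : AbsSummableAt f s := by
  refine Summable.of_nonneg_of_le (fun _ => norm_nonneg _) (fun n => ?_) hf
  rw [norm_mul, norm_mul, norm_pow, norm_pow, Real.norm_of_nonneg hs,
    Real.norm_of_nonneg (hs.trans hsr)]
  gcongr

/-! ### Majorants for quadratic recurrences -/

theorem sum_range_sum_antidiagonal_le {a : ℕ → ℝ} (ha : ∀ n, 0 ≤ a n) (N : ℕ) :
    ∑ n ∈ range N, ∑ p ∈ antidiagonal n, a p.1 * a p.2 ≤ (∑ n ∈ range N, a n) ^ 2 := by
  have hF : ∀ p : ℕ × ℕ, 0 ≤ a p.1 * a p.2 := fun p => mul_nonneg (ha _) (ha _)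
  rw [sq, sum_mul_sum, ← sum_product']
  refine le_of_eq_of_le (sum_congr rfl fun n hn => ?_)
    (sum_fiberwise_le_sum_of_sum_fiber_nonneg (s := range N ×ˢ range N) (t := range N)
      (g := fun p : ℕ × ℕ => p.1 + p.2) (f := fun p => a p.1 * a p.2)
      fun n _ => sum_nonneg fun p _ => hF p)
  refine sum_congr ?_ fun _ _ => rfl
  ext p
  simp only [HasAntidiagonal.mem_antidiagonal, mem_filter, mem_product, mem_range] at hn ⊢
  omega

/-- A nonnegative sequence obeying a quadratic recurrence with driving terms `d` has partial sums
below any `M` that satisfies the corresponding quadratic inequality. -/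
theorem sum_range_le_of_quadratic_recurrence {b d : ℕ → ℝ} {α β D M : ℝ} (hb : ∀ n, 0 ≤ b n)
    (hα : 0 ≤ α) (hβ : 0 ≤ β) (h0 : b 0 ≤ d 0)
    (hsucc : ∀ n, b (n + 1) ≤
      d (n + 1) + α * b n + β * ∑ p ∈ antidiagonal n, b p.1 * b p.2)
    (hd : ∀ N, ∑ n ∈ range N, d n ≤ D) (hM : 0 ≤ M) (hDM : D + α * M + β * M ^ 2 ≤ M) (N : ℕ) :
    ∑ n ∈ range N, b n ≤ M := by
  induction N with
  | zero => simpa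
  | succ N ih =>
    have hnn : 0 ≤ ∑ n ∈ range N, b n := sum_nonneg fun n _ => hb n
    calc ∑ n ∈ range (N + 1), b n
        ≤ d 0 + ∑ n ∈ range N,
            (d (n + 1) + α * b n + β * ∑ p ∈ antidiagonal n, b p.1 * b p.2) := by
          rw [sum_range_succ', add_comm]
          exact add_le_add h0 (sum_le_sum fun n _ => hsucc n)
      _ = ∑ n ∈ range (N + 1), d n + α * ∑ n ∈ range N, b n +
            β * ∑ n ∈ range N, ∑ p ∈ antidiagonal n, b p.1 * b p.2 := by
          rw [sum_add_distrib, sum_add_distrib, ← mul_sum, ← mul_sum, sum_range_succ' d]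
          ring
      _ ≤ D + α * M + β * M ^ 2 := by
          gcongr
          · exact hd _
          · exact (sum_range_sum_antidiagonal_le hb N).trans (by gcongr)
      _ ≤ M := hDM

/-- A power series `g` with constant term `1` whose square `h` has nonnegative coefficients
converges absolutely wherever the sum of `h` is at most `2`: the nonconstant part `s` of `g` obeys
`2 s = (h - 1) - s ^ 2`, hence is majorized by a solution of `2 t = 1 + t ^ 2`. -/
theorem absSummableAt_of_sq {g : ℝ⟦X⟧} {r : ℝ} (hr : 0 ≤ r) (hg : constantCoeff g = 1)
    (hnn : ∀ n, 0 ≤ coeff n (g ^ 2))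
    (hle : ∀ N, ∑ n ∈ range N, coeff n (g ^ 2) * r ^ n ≤ 2) : AbsSummableAt g r := by
  obtain ⟨s, hs⟩ : ∃ s, g = 1 + X * s := by
    refine ⟨PowerSeries.mk fun n => coeff (n + 1) g, ?_⟩
    ext n
    cases n with
    | zero => simp [hg]
    | succ n => simp [coeff_one]
  have hsq : g ^ 2 = 1 + X * (s + s + X * s ^ 2) := by
    rw [hs]
    ring
  have hcoeff0 : coeff 1 (g ^ 2) = 2 * coeff 0 s := by
    have := coeff_succ_X_mul 0 (s + s + X * s ^ 2)
    rw [hsq, map_add, this]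
    simp [coeff_one, two_mul]
  have hcoeff : ∀ n, coeff (n + 2) (g ^ 2) =
      2 * coeff (n + 1) s + ∑ p ∈ antidiagonal n, coeff p.1 s * coeff p.2 s := by
    intro n
    rw [hsq, show n + 2 = (n + 1) + 1 from rfl, map_add, coeff_succ_X_mul, map_add,
      map_add, coeff_succ_X_mul, sq, coeff_mul, two_mul]
    simp [coeff_one]
  have hbound := sum_range_le_of_quadratic_recurrence
    (b := fun n => |coeff n s| * r ^ (n + 1))
    (d := fun n => coeff (n + 1) (g ^ 2) * r ^ (n + 1) / 2) (α := 0) (β := 1 / 2) (D := 1 / 2)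
    (M := 1) (fun n => by positivity) le_rfl (by norm_num)
    (by
      have : 0 ≤ coeff 0 s := by linarith [hnn 1]
      simp only [zero_add, hcoeff0, abs_of_nonneg this]
      linarith)
    (fun n => by
      have h1 : 2 * |coeff (n + 1) s| ≤ coeff (n + 2) (g ^ 2) +
          ∑ p ∈ antidiagonal n, |coeff p.1 s| * |coeff p.2 s| := by
        have h2 : |∑ p ∈ antidiagonal n, coeff p.1 s * coeff p.2 s| ≤
            ∑ p ∈ antidiagonal n, |coeff p.1 s| * |coeff p.2 s| := by
          simpa only [abs_mul] using abs_sum_le_sum_abs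
            (fun p : ℕ × ℕ => coeff p.1 s * coeff p.2 s) (antidiagonal n)
        have h3 : 2 * |coeff (n + 1) s| = |2 * coeff (n + 1) s| := by
          rw [abs_mul, abs_two]
        rw [h3, show 2 * coeff (n + 1) s = coeff (n + 2) (g ^ 2) -
          ∑ p ∈ antidiagonal n, coeff p.1 s * coeff p.2 s by rw [hcoeff]; ring]
        refine (abs_sub _ _).trans ?_
        rw [abs_of_nonneg (hnn _)]
        gcongr
      have h4 : ∑ p ∈ antidiagonal n, |coeff p.1 s| * r ^ (p.1 + 1) *
          (|coeff p.2 s| * r ^ (p.2 + 1)) =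
          (∑ p ∈ antidiagonal n, |coeff p.1 s| * |coeff p.2 s|) * r ^ (n + 2) := by
        rw [sum_mul]
        refine sum_congr rfl fun p hp => ?_
        rw [← mem_antidiagonal.1 hp]
        ring
      simp only [h4]
      have := mul_le_mul_of_nonneg_right h1 (pow_nonneg hr (n + 2))
      rw [show n + 1 + 1 = n + 2 from rfl]
      linarith)
    (fun N => by
      have := hle (N + 1)
      rw [sum_range_succ'] at this
      simp only [coeff_zero_eq_constantCoeff, map_pow, hg] at this
      rw [← sum_div]
      norm_num at this
      linarith)
    zero_le_one (by norm_num)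
  refine (summable_nat_add_iff 1).1
    (summable_of_sum_range_le (c := 1) (fun _ => norm_nonneg _) fun N => ?_)
  refine le_of_eq_of_le (sum_congr rfl fun n _ => ?_) (hbound N)
  rw [hs, map_add, coeff_succ_X_mul, norm_mul, norm_pow, Real.norm_of_nonneg hr]
  simp [coeff_one]

/-! ### Convolution with a sequence of smaller growth -/

/-- If `a n / a (n + 1)` tends to a limit below `r`, then `|a n| * r ^ n` is increasing up to a
constant factor. -/
theorem exists_mul_pow_le {a : ℕ → ℝ} {ρ r : ℝ} (ha : ∀ n, a n ≠ 0)
    (hlim : Tendsto (fun n => a n / a (n + 1)) atTop (𝓝 ρ)) (hρ : 0 ≤ ρ) (hr : ρ < r) :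
    ∃ K, 0 ≤ K ∧ ∀ m n, m ≤ n → |a m| * r ^ m ≤ K * (|a n| * r ^ n) := by
  have hr0 : 0 < r := hρ.trans_lt hr
  have hy : ∀ n, 0 < |a n| * r ^ n := fun n => mul_pos (abs_pos.2 (ha n)) (pow_pos hr0 n)
  have hev : ∀ᶠ n in atTop, |a n / a (n + 1)| < r :=
    (hlim.abs).eventually_lt_const (by rwa [abs_of_nonneg hρ])
  obtain ⟨M, hM⟩ := eventually_atTop.1 hev
  have hstep : ∀ m, M ≤ m → |a m| * r ^ m ≤ |a (m + 1)| * r ^ (m + 1) := by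
    intro m hm
    have h1 := (hM m hm).le
    rw [abs_div, div_le_iff₀ (abs_pos.2 (ha _))] at h1
    calc |a m| * r ^ m ≤ (r * |a (m + 1)|) * r ^ m := by gcongr
      _ = |a (m + 1)| * r ^ (m + 1) := by ring
  -- the finitely many indices below `M` only enlarge the constant; they are added one by one
  suffices h : ∀ j ≤ M, ∃ K, 1 ≤ K ∧
      ∀ m n, M - j ≤ m → m ≤ n → |a m| * r ^ m ≤ K * (|a n| * r ^ n) by
    obtain ⟨K, hK, h⟩ := h M le_rfl
    exact ⟨K, by linarith, fun m n hmn => h m n (by omega) hmn⟩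
  intro j
  induction j with
  | zero =>
    refine fun _ => ⟨1, le_rfl, fun m n hm hmn => ?_⟩
    rw [one_mul]
    induction n, hmn using Nat.le_induction with
    | base => exact le_rfl
    | succ n hmn ih => exact ih.trans (hstep n (by omega))
  | succ j ih =>
    intro hj
    obtain ⟨K, hK, h⟩ := ih (by omega)
    set m₀ := M - (j + 1) with hm₀
    set q := (|a m₀| * r ^ m₀) / (|a (m₀ + 1)| * r ^ (m₀ + 1)) with hq
    have hq0 : 0 ≤ q := (div_pos (hy _) (hy _)).le
    refine ⟨max K (q * K), hK.trans (le_max_left _ _), fun m n hm hmn => ?_⟩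
    rcases hm.eq_or_lt with rfl | hlt
    · rcases hmn.eq_or_lt with rfl | hlt'
      · exact le_mul_of_one_le_left (hy _).le (hK.trans (le_max_left _ _))
      · calc |a m₀| * r ^ m₀ = q * (|a (m₀ + 1)| * r ^ (m₀ + 1)) := by
              rw [hq, div_mul_cancel₀ _ (hy _).ne']
          _ ≤ q * (K * (|a n| * r ^ n)) := by
              exact mul_le_mul_of_nonneg_left (h _ _ (by omega) hlt') hq0
          _ = (q * K) * (|a n| * r ^ n) := by ring
          _ ≤ max K (q * K) * (|a n| * r ^ n) := by
              exact mul_le_mul_of_nonneg_right (le_max_right _ _) (hy n).le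
    · refine (h m n (by omega) hmn).trans ?_
      exact mul_le_mul_of_nonneg_right (le_max_left _ _) (hy n).le

theorem tendsto_sub_div {a : ℕ → ℝ} {ρ : ℝ} (ha : ∀ n, a n ≠ 0)
    (hlim : Tendsto (fun n => a n / a (n + 1)) atTop (𝓝 ρ)) (k : ℕ) :
    Tendsto (fun n => a (n - k) / a n) atTop (𝓝 (ρ ^ k)) := by
  rw [← tendsto_add_atTop_iff_nat k]
  simp only [Nat.add_sub_cancel]
  induction k with
  | zero => simp [ha]
  | succ k ih =>
    have h := ih.mul ((tendsto_add_atTop_iff_nat k).2 hlim)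
    rw [pow_succ]
    refine h.congr fun n => ?_
    rw [div_mul_div_cancel₀ (ha _), add_assoc]

/-- **Bender's theorem.** If the coefficients of `f` have ratios `a n / a (n + 1)` tending to `ρ`
and `g` converges absolutely beyond `ρ`, then the coefficients of `g * f` are asymptotic to `g(ρ)`
times those of `f`. -/
theorem tendsto_coeff_mul_div {f g : ℝ⟦X⟧} {ρ r : ℝ} (hf : ∀ n, coeff n f ≠ 0)
    (hlim : Tendsto (fun n => coeff n f / coeff (n + 1) f) atTop (𝓝 ρ)) (hρ : 0 ≤ ρ) (hr : ρ < r)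
    (hg : AbsSummableAt g r) :
    Tendsto (fun n => coeff n (g * f) / coeff n f) atTop (𝓝 (evalAt g ρ)) := by
  obtain ⟨K, hK, hKle⟩ := exists_mul_pow_le hf hlim hρ hr
  have hr0 : 0 < r := hρ.trans_lt hr
  have key : Tendsto (fun n => ∑' k, if k ≤ n then coeff k g * (coeff (n - k) f / coeff n f) else 0)
      atTop (𝓝 (∑' k, coeff k g * ρ ^ k)) := by
    refine tendsto_tsum_of_dominated_convergence (bound := fun k => K * ‖coeff k g * r ^ k‖)
      (Summable.mul_left K hg) (fun k => ?_) (Eventually.of_forall fun n k => ?_)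
    · refine ((tendsto_sub_div hf hlim k).const_mul (coeff k g)).congr' ?_
      filter_upwards [eventually_ge_atTop k] with n hn
      rw [if_pos hn]
    · split_ifs with hkn
      · have h1 := hKle (n - k) n (Nat.sub_le _ _)
        have h2 : |coeff (n - k) f| ≤ K * r ^ k * |coeff n f| := by
          have h3 : r ^ n = r ^ k * r ^ (n - k) := by rw [← pow_add, Nat.add_sub_cancel' hkn]
          rw [h3] at h1
          refine le_of_mul_le_mul_right ?_ (pow_pos hr0 (n - k))
          linarith
        rw [norm_mul, norm_mul, norm_pow, Real.norm_of_nonneg hr0.le, norm_div]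
        have h4 : ‖coeff (n - k) f‖ / ‖coeff n f‖ ≤ K * r ^ k := by
          rw [div_le_iff₀ (norm_pos_iff.2 (hf n))]
          exact h2
        calc ‖coeff k g‖ * (‖coeff (n - k) f‖ / ‖coeff n f‖)
            ≤ ‖coeff k g‖ * (K * r ^ k) := by gcongr
          _ = K * (‖coeff k g‖ * r ^ k) := by ring
      · simpa using mul_nonneg hK (norm_nonneg (coeff k g * r ^ k))
  refine key.congr fun n => ?_
  rw [tsum_eq_sum (s := range (n + 1)) fun k hk => if_neg (by simpa using hk), coeff_mul,
    Nat.sum_antidiagonal_eq_sum_range_succ (fun i j => coeff i g * coeff j f), sum_div]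
  refine sum_congr rfl fun k hk => ?_
  rw [if_pos (by simpa [Nat.lt_succ_iff] using hk), mul_div_assoc]

/-! ### The square root of a linear polynomial -/

/-- The power series of `√(1 - c X)`. -/
noncomputable def sqrtSeries (c : ℝ) : ℝ⟦X⟧ :=
  rescale (-c) (PowerSeries.binomialSeries ℝ (1 / 2 : ℝ))

theorem sqrtSeries_sq (c : ℝ) : sqrtSeries c ^ 2 = 1 - C c * X := by
  have h : PowerSeries.binomialSeries ℝ (1 / 2 : ℝ) * PowerSeries.binomialSeries ℝ (1 / 2 : ℝ) =
      1 + X := by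
    rw [← binomialSeries_add, show (1 / 2 + 1 / 2 : ℝ) = ((1 : ℕ) : ℝ) by norm_num,
      binomialSeries_nat, pow_one]
  rw [sqrtSeries, sq, ← map_mul, h, map_add, map_one, rescale_X, map_neg]
  ring

theorem coeff_sqrtSeries_zero (c : ℝ) : coeff 0 (sqrtSeries c) = 1 := by
  simp [sqrtSeries, coeff_rescale]

theorem coeff_sqrtSeries_eq_prod (c : ℝ) (n : ℕ) :
    coeff n (sqrtSeries c) = c ^ n * (∏ j ∈ range n, (-(1 / 2) + (j : ℝ))) / n.factorial := by
  have h : ∀ n : ℕ, (descPochhammer ℤ n).smeval (1 / 2 : ℝ) =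
      (-1) ^ n * ∏ j ∈ range n, (-(1 / 2) + (j : ℝ)) := by
    intro n
    induction n with
    | zero => simp
    | succ n ih =>
      rw [descPochhammer_succ_right, Polynomial.smeval_mul, ih, prod_range_succ]
      simp only [Polynomial.smeval_sub, Polynomial.smeval_X, Polynomial.smeval_natCast]
      simp
      ring
  rw [sqrtSeries, coeff_rescale, binomialSeries_coeff, Ring.choose_eq_smul, h, neg_pow]
  simp only [smul_eq_mul, mul_one]
  have : ((-1 : ℝ) ^ n) * (-1) ^ n = 1 := by rw [← mul_pow]; simp
  generalize ∏ j ∈ range n, (-(1 / 2) + (j : ℝ)) = P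
  rw [div_eq_mul_inv]
  linear_combination (c ^ n * P * (n.factorial : ℝ)⁻¹) * this

theorem coeff_sqrtSeries_succ (c : ℝ) (n : ℕ) :
    coeff (n + 1) (sqrtSeries c) = coeff n (sqrtSeries c) * (c * (n - 1 / 2) / (n + 1)) := by
  rw [coeff_sqrtSeries_eq_prod, coeff_sqrtSeries_eq_prod, prod_range_succ, Nat.factorial_succ]
  push_cast
  have : (n.factorial : ℝ) ≠ 0 := by positivity
  field_simp
  ring

theorem coeff_sqrtSeries_succ_neg {c : ℝ} (hc : 0 < c) (n : ℕ) :
    coeff (n + 1) (sqrtSeries c) < 0 := by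
  induction n with
  | zero =>
    rw [coeff_sqrtSeries_succ, coeff_sqrtSeries_zero]
    norm_num
    linarith
  | succ n ih =>
    rw [coeff_sqrtSeries_succ]
    refine mul_neg_of_neg_of_pos ih ?_
    have : (0 : ℝ) < ((n + 1 : ℕ) : ℝ) - 1 / 2 := by
      push_cast
      linarith [(n.cast_nonneg : (0 : ℝ) ≤ n)]
    positivity

theorem coeff_sqrtSeries_ne_zero {c : ℝ} (hc : 0 < c) (n : ℕ) : coeff n (sqrtSeries c) ≠ 0 := by
  cases n with
  | zero => simp [coeff_sqrtSeries_zero]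
  | succ n => exact (coeff_sqrtSeries_succ_neg hc n).ne

theorem tendsto_coeff_sqrtSeries_div {c : ℝ} (hc : 0 < c) :
    Tendsto (fun n => coeff n (sqrtSeries c) / coeff (n + 1) (sqrtSeries c)) atTop (𝓝 c⁻¹) := by
  have h : Tendsto (fun n : ℕ => c⁻¹ * (1 + (3 / 2) / ((n : ℝ) - 1 / 2))) atTop
      (𝓝 (c⁻¹ * (1 + 0))) := by
    refine ((tendsto_const_nhds.div_atTop ?_).const_add 1).const_mul _
    exact tendsto_atTop_add_const_right _ (-(1 / 2)) tendsto_natCast_atTop_atTop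
  rw [add_zero, mul_one] at h
  refine h.congr' ?_
  filter_upwards [eventually_ge_atTop 1] with n hn
  have h1 : (1 : ℝ) ≤ n := by exact_mod_cast hn
  have h2 : (n : ℝ) - 1 / 2 ≠ 0 := by linarith
  rw [coeff_sqrtSeries_succ]
  have := coeff_sqrtSeries_ne_zero hc n
  rw [div_mul_eq_div_div, div_self this]
  have h3 : (n : ℝ) + 1 = (n - 1 / 2) + 3 / 2 := by ring
  rw [h3]
  generalize (n : ℝ) - 1 / 2 = x at h2
  field_simp

/-- The asymptotic size of the coefficients of `√(1 - c X)`, read off from Euler's limit formula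
for `Γ(-1/2) = -2 √π`. -/
theorem tendsto_coeff_sqrtSeries {c : ℝ} (hc : 0 < c) :
    Tendsto (fun n : ℕ => coeff n (sqrtSeries c) * c⁻¹ ^ n * (n : ℝ) ^ (3 / 2 : ℝ)) atTop
      (𝓝 (-(1 / (2 * √Real.pi)))) := by
  have hpi : 0 < √Real.pi := Real.sqrt_pos.2 Real.pi_pos
  have hGamma : Real.Gamma (-(1 / 2)) = -(2 * √Real.pi) := by
    have := Real.Gamma_add_one (s := -(1 / 2)) (by norm_num)
    rw [show -(1 / 2 : ℝ) + 1 = 1 / 2 by norm_num, Real.Gamma_one_half_eq] at this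
    linarith
  have h1 : Tendsto (fun n : ℕ => (1 + (1 / 2) / ((n : ℝ) - 1 / 2))) atTop (𝓝 (1 + 0)) := by
    refine (tendsto_const_nhds.div_atTop ?_).const_add 1
    exact tendsto_atTop_add_const_right _ (-(1 / 2)) tendsto_natCast_atTop_atTop
  have h2 := h1.div (Real.GammaSeq_tendsto_Gamma (-(1 / 2))) (by rw [hGamma]; linarith)
  rw [hGamma, add_zero, div_neg] at h2
  refine h2.congr' ?_
  filter_upwards [eventually_ge_atTop 1] with n hn
  have hn1 : (1 : ℝ) ≤ n := by exact_mod_cast hn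
  have hn0 : (0 : ℝ) < n := by linarith
  have hhalf : -(1 / 2 : ℝ) + n ≠ 0 := by linarith
  have hhalf' : (n : ℝ) - 1 / 2 ≠ 0 := by linarith
  have hprod : ∏ j ∈ range n, (-(1 / 2) + (j : ℝ)) ≠ 0 := by
    intro h0
    have := coeff_sqrtSeries_ne_zero hc n
    rw [coeff_sqrtSeries_eq_prod, h0] at this
    simp at this
  have hfac : (n.factorial : ℝ) ≠ 0 := by positivity
  have hpow : (n : ℝ) ^ (3 / 2 : ℝ) * (n : ℝ) ^ (-(1 / 2) : ℝ) = n := by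
    rw [← Real.rpow_add hn0]
    norm_num
  have hpow0 : (n : ℝ) ^ (-(1 / 2) : ℝ) ≠ 0 := (Real.rpow_pos_of_pos hn0 _).ne'
  have hc' : c⁻¹ ^ n * c ^ n = 1 := by rw [← mul_pow, inv_mul_cancel₀ hc.ne', one_pow]
  rw [Pi.div_apply, Real.GammaSeq, coeff_sqrtSeries_eq_prod, prod_range_succ, div_div_eq_mul_div,
    div_eq_iff (mul_ne_zero hpow0 hfac)]
  set P := ∏ j ∈ range n, (-(1 / 2) + (j : ℝ))
  have e1 : (1 + 1 / 2 / ((n : ℝ) - 1 / 2)) * (P * (-(1 / 2) + n)) = P * n := by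
    rw [show -(1 / 2 : ℝ) + n = n - 1 / 2 by ring]
    have e2 : 1 / 2 / ((n : ℝ) - 1 / 2) * (n - 1 / 2) = 1 / 2 := div_mul_cancel₀ _ hhalf'
    linear_combination P * e2
  have e3 : c ^ n * P / n.factorial * n.factorial = c ^ n * P := div_mul_cancel₀ _ hfac
  rw [e1]
  symm
  calc c ^ n * P / n.factorial * c⁻¹ ^ n * (n : ℝ) ^ (3 / 2 : ℝ) *
        ((n : ℝ) ^ (-(1 / 2) : ℝ) * n.factorial)
      = (c ^ n * P / n.factorial * n.factorial) * c⁻¹ ^ n *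
        ((n : ℝ) ^ (3 / 2 : ℝ) * (n : ℝ) ^ (-(1 / 2) : ℝ)) := by ring
    _ = P * n * (c⁻¹ ^ n * c ^ n) := by rw [e3, hpow]; ring
    _ = P * n := by rw [hc', mul_one]

/-! ### The radius `rho` -/

theorem sqrt_545_bounds : 23.34523505 < √545 ∧ √545 < 23.34523507 := by
  constructor
  · rw [Real.lt_sqrt (by norm_num)]
    norm_num
  · rw [Real.sqrt_lt' (by norm_num)]
    norm_num

theorem rho_bounds : 0.165476493 < rho ∧ rho < 0.165476495 := by
  have := sqrt_545_bounds
  unfold rho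
  constructor <;> linarith

theorem rho_pos : 0 < rho := by linarith [rho_bounds.1]

theorem rho_quadratic : 5 * rho ^ 2 - 25 * rho + 4 = 0 := by
  have h : √545 ^ 2 = 545 := Real.sq_sqrt (by norm_num)
  unfold rho
  linear_combination h / 20

/-! ### The generating series of terms near `rho` -/

/-- The quadratic equation of the generating series of terms, at a point of absolute
convergence. -/
theorem eval_quadratic {𝕜 : Type*} [NormedField 𝕜] [CompleteSpace 𝕜] {f : 𝕜⟦X⟧} {z : 𝕜}
    (hf : (1 - X) * f = X + X * (1 - X) * (f + f ^ 2)) (hz : AbsSummableAt f z) :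
    (1 - z) * evalAt f z = z + z * (1 - z) * (evalAt f z + evalAt f z ^ 2) := by
  have h1 : AbsSummableAt (1 - X : 𝕜⟦X⟧) z := (absSummableAt_one z).sub (absSummableAt_X z)
  have h2 := hz.add (hz.mul hz)
  have h3 := (absSummableAt_X z).mul h1
  have := congrArg (fun g => evalAt g z) hf
  simp only [sq] at this ⊢
  rwa [evalAt_mul h1 hz, evalAt_add (absSummableAt_X z) (h3.mul h2), evalAt_mul h3 h2,
    evalAt_mul (absSummableAt_X z) h1, evalAt_add hz (hz.mul hz), evalAt_mul hz hz,
    evalAt_sub (absSummableAt_one z) (absSummableAt_X z), evalAt_one, evalAt_X] at this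

theorem coeff_termSeries (n : ℕ) : coeff n termSeries = termCount n := coeff_mk _ _

theorem sum_range_termSeries_le (N : ℕ) :
    ∑ n ∈ range N, coeff n termSeries * (1 / 5) ^ n ≤ 7 / 20 := by
  -- `7 / 20` satisfies `1 / 4 + M / 5 + M ^ 2 / 5 ≤ M`
  refine sum_range_le_of_quadratic_recurrence (α := 1 / 5) (β := 1 / 5) (D := 1 / 4)
    (d := fun n => if n = 0 then 0 else (1 / 5) ^ n) (fun n => ?_) (by norm_num) (by norm_num) ?_
    (fun n => ?_) (fun N => ?_) (by norm_num) (by norm_num) N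
  · rw [coeff_termSeries]
    positivity
  · simp [coeff_termSeries, termCount_zero]
  · have h : ∑ p ∈ antidiagonal n, coeff p.1 termSeries * (1 / 5 : ℝ) ^ p.1 *
        (coeff p.2 termSeries * (1 / 5) ^ p.2) =
        (∑ p ∈ antidiagonal n, (termCount p.1 : ℝ) * termCount p.2) * (1 / 5) ^ n := by
      rw [← coeff_mul_mul_pow, coeff_mul]
      simp only [coeff_termSeries]
    rw [h]
    simp only [coeff_termSeries, termCount_succ]
    push_cast
    exact le_of_eq (by ring)
  · cases N with
    | zero => simp
    | succ N =>
      rw [sum_range_succ']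
      simp only [Nat.add_eq_zero_iff, one_ne_zero, and_false, if_false, if_true, add_zero, pow_succ]
      rw [← sum_mul, geom_sum_eq (by norm_num), show (1 / 5 - 1 : ℝ) = -(4 / 5) by norm_num]
      have : (0 : ℝ) < (1 / 5) ^ N := by positivity
      linarith

theorem norm_coeff_termSeries_mul {x : ℝ} (hx : 0 ≤ x) (n : ℕ) :
    ‖coeff n termSeries * x ^ n‖ = coeff n termSeries * x ^ n := by
  rw [Real.norm_of_nonneg]
  rw [coeff_termSeries]
  positivity

theorem absSummableAt_termSeries : AbsSummableAt termSeries (1 / 5) := by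
  refine summable_of_sum_range_le (c := 7 / 20) (fun _ => norm_nonneg _) fun N => ?_
  simp only [norm_coeff_termSeries_mul (by norm_num : (0 : ℝ) ≤ 1 / 5)]
  exact sum_range_termSeries_le N

theorem evalAt_termSeries_le : evalAt termSeries (1 / 5) ≤ 7 / 20 := by
  refine Summable.tsum_le_of_sum_range_le (Summable.of_norm absSummableAt_termSeries) fun N => ?_
  exact sum_range_termSeries_le N

theorem absSummableAt_termSeries_rho : AbsSummableAt termSeries rho :=
  absSummableAt_termSeries.of_le rho_pos.le (by linarith [rho_bounds.2])

/-- At `rho` the quadratic equation for `L` has the roots `1/4` and `(1 - rho) / rho - 1/4`; the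
second one exceeds the value at `1/5`. -/
theorem evalAt_termSeries_rho : evalAt termSeries rho = 1 / 4 := by
  have hb := rho_bounds
  have hle : evalAt termSeries rho ≤ 7 / 20 := by
    refine le_trans ?_ evalAt_termSeries_le
    refine Summable.tsum_le_tsum (fun n => ?_) (Summable.of_norm absSummableAt_termSeries_rho)
      (Summable.of_norm absSummableAt_termSeries)
    rw [coeff_termSeries]
    have := rho_pos
    gcongr
    linarith
  have hq := eval_quadratic termSeries_eq absSummableAt_termSeries_rho
  have hr := rho_quadratic
  set y := evalAt termSeries rho
  have hfac : (y - 1 / 4) * ((1 - rho) * (rho * (y + 1 / 4) - (1 - rho))) = 0 := by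
    linear_combination -hq + hr / 16
  rcases mul_eq_zero.1 hfac with h | h
  · linarith
  · rcases mul_eq_zero.1 h with h | h
    · linarith
    · nlinarith

/-! ### The regular factor of `√(1 - 4 L)` -/

/-- The quotient of `1 - 2 C = √(1 - 4 L)` by `√(1 - X / rho)`. -/
noncomputable def regularFactor : ℝ⟦X⟧ := (1 - 2 * closSeries) * (sqrtSeries rho⁻¹)⁻¹

theorem regularFactor_mul_sqrtSeries :
    regularFactor * sqrtSeries rho⁻¹ = 1 - 2 * closSeries := by
  rw [regularFactor, mul_assoc, PowerSeries.inv_mul_cancel, mul_one]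
  rw [← coeff_zero_eq_constantCoeff_apply, coeff_sqrtSeries_zero]
  exact one_ne_zero

theorem regularFactor_sq_mul : regularFactor ^ 2 * (1 - C rho⁻¹ * X) = 1 - 4 * termSeries := by
  rw [← sqrtSeries_sq, ← mul_pow, regularFactor_mul_sqrtSeries, one_sub_two_closSeries_sq]

theorem constantCoeff_regularFactor : constantCoeff regularFactor = 1 := by
  have h := congrArg constantCoeff regularFactor_mul_sqrtSeries
  have h0 : constantCoeff closSeries = 0 := by
    rw [← coeff_zero_eq_constantCoeff_apply, closSeries, coeff_mk, closureCount_zero, Nat.cast_zero]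
  rw [map_mul, ← coeff_zero_eq_constantCoeff_apply (sqrtSeries _), coeff_sqrtSeries_zero, map_sub,
    map_mul, h0] at h
  simpa using h

theorem coeff_succ_regularFactor_sq (n : ℕ) : coeff (n + 1) (regularFactor ^ 2) =
    rho⁻¹ * coeff n (regularFactor ^ 2) - 4 * coeff (n + 1) termSeries := by
  have h := congrArg (coeff (n + 1)) regularFactor_sq_mul
  have e : regularFactor ^ 2 * (1 - C rho⁻¹ * X) =
      regularFactor ^ 2 - C rho⁻¹ * (regularFactor ^ 2 * X) := by ring
  have e4 : (4 : ℝ⟦X⟧) = C 4 := (map_ofNat C 4).symm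
  rw [e, e4, map_sub, map_sub, coeff_C_mul, coeff_succ_mul_X, coeff_C_mul, coeff_one,
    if_neg (by omega)] at h
  linarith

/-- Since `4 L(rho) = 1`, the coefficients of `(1 - 4 L) / (1 - X / rho)` are tails of the series
`4 L(rho)`. -/
theorem coeff_regularFactor_sq_mul_pow (n : ℕ) : coeff n (regularFactor ^ 2) * rho ^ n =
    4 * ∑' k, coeff (k + (n + 1)) termSeries * rho ^ (k + (n + 1)) := by
  have h1 : coeff n (regularFactor ^ 2) * rho ^ n =
      1 - 4 * ∑ k ∈ range (n + 1), coeff k termSeries * rho ^ k := by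
    induction n with
    | zero => simp [coeff_termSeries, termCount_zero, constantCoeff_regularFactor]
    | succ n ih =>
      rw [sum_range_succ, coeff_succ_regularFactor_sq]
      have : rho⁻¹ * rho = 1 := inv_mul_cancel₀ rho_pos.ne'
      linear_combination ih + coeff n (regularFactor ^ 2) * rho ^ n * this
  have h2 := (Summable.of_norm absSummableAt_termSeries_rho).sum_add_tsum_nat_add (n + 1)
  have h3 := evalAt_termSeries_rho
  rw [evalAt] at h3
  rw [h1]
  linarith

theorem coeff_regularFactor_sq_nonneg (n : ℕ) : 0 ≤ coeff n (regularFactor ^ 2) := by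
  have h : 0 ≤ coeff n (regularFactor ^ 2) * rho ^ n := by
    rw [coeff_regularFactor_sq_mul_pow]
    refine mul_nonneg (by norm_num) (tsum_nonneg fun k => ?_)
    rw [coeff_termSeries]
    have := rho_pos
    positivity
  exact nonneg_of_mul_nonneg_left h (pow_pos rho_pos n)

/-- The partial sums at `1/5` of `(1 - 4 L) / (1 - X / rho)` stay below the value
`(4 L(1/5) - 1) / (1 / (5 rho) - 1)` of that quotient. -/
theorem sum_range_regularFactor_sq_le (N : ℕ) :
    ∑ n ∈ range N, coeff n (regularFactor ^ 2) * (1 / 5) ^ n ≤ 2 := by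
  have hρ := rho_pos
  have hb := rho_bounds
  have hid : (rho⁻¹ / 5 - 1) * ∑ n ∈ range N, coeff n (regularFactor ^ 2) * (1 / 5) ^ n =
      coeff N (regularFactor ^ 2) * (1 / 5) ^ N - 1 +
        4 * ∑ k ∈ range (N + 1), coeff k termSeries * (1 / 5) ^ k := by
    induction N with
    | zero => simp [coeff_termSeries, termCount_zero, constantCoeff_regularFactor]
    | succ N ih =>
      rw [sum_range_succ, sum_range_succ _ (N + 1), mul_add, ih, coeff_succ_regularFactor_sq]
      ring
  have htail : coeff N (regularFactor ^ 2) * (1 / 5) ^ N ≤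
      4 * ∑' k, coeff (k + (N + 1)) termSeries * (1 / 5) ^ (k + (N + 1)) := by
    have hpow := pow_pos hρ N
    refine le_of_mul_le_mul_right ?_ hpow
    calc coeff N (regularFactor ^ 2) * (1 / 5) ^ N * rho ^ N
        = (coeff N (regularFactor ^ 2) * rho ^ N) * (1 / 5) ^ N := by ring
      _ = 4 * ∑' k, coeff (k + (N + 1)) termSeries * rho ^ (k + (N + 1)) * (1 / 5) ^ N := by
          rw [coeff_regularFactor_sq_mul_pow, tsum_mul_right, mul_assoc]
      _ ≤ 4 * ∑' k, coeff (k + (N + 1)) termSeries * (1 / 5) ^ (k + (N + 1)) * rho ^ N := by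
          refine mul_le_mul_of_nonneg_left (Summable.tsum_le_tsum (fun k => ?_) ?_ ?_) (by norm_num)
          · rw [show k + (N + 1) = (k + 1) + N by ring, pow_add _ _ N, pow_add _ _ N,
              coeff_termSeries]
            have : rho ^ (k + 1) ≤ (1 / 5) ^ (k + 1) := by
              gcongr
              linarith
            calc (termCount (k + 1 + N) : ℝ) * (rho ^ (k + 1) * rho ^ N) * (1 / 5) ^ N
                = termCount (k + 1 + N) * rho ^ (k + 1) * (rho ^ N * (1 / 5) ^ N) := by ring
              _ ≤ termCount (k + 1 + N) * (1 / 5) ^ (k + 1) * (rho ^ N * (1 / 5) ^ N) := by gcongr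
              _ = _ := by ring
          · exact ((summable_nat_add_iff (N + 1)).2
              (Summable.of_norm absSummableAt_termSeries_rho)).mul_right _
          · exact ((summable_nat_add_iff (N + 1)).2
              (Summable.of_norm absSummableAt_termSeries)).mul_right _
      _ = _ := by rw [tsum_mul_right, mul_assoc]
  have hsum := (Summable.of_norm absSummableAt_termSeries).sum_add_tsum_nat_add (N + 1)
  have hle := evalAt_termSeries_le
  rw [evalAt] at hle
  have hinv : 6 ≤ rho⁻¹ := by
    rw [le_inv_comm₀ (by norm_num) hρ]
    linarith
  have hP : 0 ≤ ∑ n ∈ range N, coeff n (regularFactor ^ 2) * (1 / 5 : ℝ) ^ n :=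
    sum_nonneg fun n _ => mul_nonneg (coeff_regularFactor_sq_nonneg n) (by positivity)
  nlinarith

theorem absSummableAt_regularFactor : AbsSummableAt regularFactor (1 / 5) :=
  absSummableAt_of_sq (by norm_num) constantCoeff_regularFactor coeff_regularFactor_sq_nonneg
    sum_range_regularFactor_sq_le

/-- Multiplying `1 - 4 L` by its conjugate (`L` replaced by the other root of its quadratic
equation) shows that the square of the regular factor is
`(4 - 5 rho X) / ((1 - X) (4 - 5 X - 4 X L))`. -/
theorem regularFactor_sq_eq :
    regularFactor * regularFactor * ((1 - X) * (C 4 - C 5 * X - C 4 * (X * termSeries))) =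
      C 4 - C (5 * rho) * X := by
  have hne : (1 - C rho⁻¹ * X : ℝ⟦X⟧) ≠ 0 := by
    intro h
    simpa using congrArg constantCoeff h
  have e4 : (C 4 : ℝ⟦X⟧) = 4 := map_ofNat C 4
  have e5 : (C 5 : ℝ⟦X⟧) = 5 := map_ofNat C 5
  have h1 : C rho⁻¹ * C rho = (1 : ℝ⟦X⟧) := by
    rw [← map_mul, inv_mul_cancel₀ rho_pos.ne', map_one]
  have h2 : 5 * C rho + 4 * C rho⁻¹ = (25 : ℝ⟦X⟧) := by
    have : 5 * rho + 4 * rho⁻¹ = 25 := by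
      have := rho_quadratic
      have := rho_pos
      field_simp
      linarith
    rw [← e4, ← e5, ← map_mul, ← map_mul, ← map_add, this]
    exact map_ofNat C 25
  refine mul_left_cancel₀ hne ?_
  rw [map_mul, e4, e5]
  linear_combination (1 - X) * (4 - 5 * X - 4 * X * termSeries) * regularFactor_sq_mul
    - 16 * termSeries_eq + X * h2 - 5 * X ^ 2 * h1

theorem evalAt_regularFactor_sq :
    evalAt regularFactor rho ^ 2 * ((1 - rho) * (4 - 6 * rho)) = 4 - 5 * rho ^ 2 := by
  have hG : AbsSummableAt regularFactor rho :=
    absSummableAt_regularFactor.of_le rho_pos.le (by linarith [rho_bounds.2])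
  have hL := absSummableAt_termSeries_rho
  have hX := absSummableAt_X rho
  have hC := fun a => absSummableAt_C a rho
  have h1X := (absSummableAt_one rho).sub hX
  have h45 := (hC 4).sub ((hC 5).mul hX)
  have hXL := (hC 4).mul (hX.mul hL)
  have h := congrArg (fun f => evalAt f rho) regularFactor_sq_eq
  rw [evalAt_mul (hG.mul hG) (h1X.mul (h45.sub hXL)), evalAt_mul hG hG,
    evalAt_mul h1X (h45.sub hXL), evalAt_sub (absSummableAt_one rho) hX, evalAt_sub h45 hXL,
    evalAt_sub (hC 4) ((hC 5).mul hX), evalAt_sub (hC 4) ((hC _).mul hX),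
    evalAt_mul (hC 5) hX, evalAt_mul (hC _) hX, evalAt_mul (hC 4) (hX.mul hL), evalAt_mul hX hL,
    evalAt_termSeries_rho, evalAt_one, evalAt_X, evalAt_C, evalAt_C, evalAt_C] at h
  linear_combination h

/-! ### Asymptotics of the coefficients -/

theorem coeff_closSeries (n : ℕ) : coeff n closSeries = closureCount n := coeff_mk _ _

theorem tendsto_closureCount_div :
    Tendsto (fun n => (closureCount n : ℝ) / coeff n (sqrtSeries rho⁻¹)) atTop
      (𝓝 (-(evalAt regularFactor rho / 2))) := by
  have hc := inv_pos.2 rho_pos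
  have h := tendsto_coeff_mul_div (coeff_sqrtSeries_ne_zero hc)
    (tendsto_coeff_sqrtSeries_div hc) (by rw [inv_inv]; exact rho_pos.le)
    (by rw [inv_inv]; linarith [rho_bounds.2]) absSummableAt_regularFactor
  rw [inv_inv, regularFactor_mul_sqrtSeries] at h
  refine ((h.div_const 2).neg).congr' ?_
  filter_upwards [eventually_ge_atTop 1] with n hn
  have e2 : (2 : ℝ⟦X⟧) = C 2 := (map_ofNat C 2).symm
  rw [map_sub, e2, coeff_C_mul, coeff_closSeries, coeff_one, if_neg (by omega)]
  ring

/-- `G(rho)` is a limit of quotients of numbers of known sign, which decides between the two square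
roots of `G(rho) ^ 2`. -/
theorem evalAt_regularFactor_pos : 0 < evalAt regularFactor rho := by
  have hnn : 0 ≤ evalAt regularFactor rho := by
    have h : -(evalAt regularFactor rho / 2) ≤ 0 := by
      refine le_of_tendsto tendsto_closureCount_div ?_
      filter_upwards [eventually_ge_atTop 1] with n hn
      obtain ⟨m, rfl⟩ := Nat.exists_eq_add_of_le' hn
      exact div_nonpos_of_nonneg_of_nonpos (Nat.cast_nonneg _)
        (coeff_sqrtSeries_succ_neg (inv_pos.2 rho_pos) m).le
    linarith
  refine hnn.lt_of_ne fun h0 => ?_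
  have h := evalAt_regularFactor_sq
  rw [← h0] at h
  have := rho_bounds
  nlinarith

theorem tendsto_closureCount :
    Tendsto (fun n : ℕ => (closureCount n : ℝ) * rho ^ n * (n : ℝ) ^ (3 / 2 : ℝ)) atTop
      (𝓝 (evalAt regularFactor rho / (4 * √Real.pi))) := by
  have hc := inv_pos.2 rho_pos
  have h := tendsto_closureCount_div.mul (tendsto_coeff_sqrtSeries hc)
  rw [inv_inv] at h
  have e : -(evalAt regularFactor rho / 2) * -(1 / (2 * √Real.pi)) =
      evalAt regularFactor rho / (4 * √Real.pi) := by
    have : √Real.pi ≠ 0 := (Real.sqrt_pos.2 Real.pi_pos).ne'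
    field_simp
    norm_num
  rw [e] at h
  refine h.congr fun n => ?_
  have := coeff_sqrtSeries_ne_zero hc n
  generalize coeff n (sqrtSeries rho⁻¹) = b at this ⊢
  field_simp

theorem tendsto_closureCount_ratio :
    Tendsto (fun n => (closureCount n : ℝ) / closureCount (n + 1)) atTop (𝓝 rho) := by
  have hc := inv_pos.2 rho_pos
  have hne : -(evalAt regularFactor rho / 2) ≠ 0 := by linarith [evalAt_regularFactor_pos]
  have h := (tendsto_closureCount_div.div
    ((tendsto_add_atTop_iff_nat 1).2 tendsto_closureCount_div) hne).mul
    (tendsto_coeff_sqrtSeries_div hc)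
  rw [inv_inv, div_self hne, one_mul] at h
  refine h.congr fun n => ?_
  have h1 := coeff_sqrtSeries_ne_zero hc n
  have h2 := coeff_sqrtSeries_ne_zero hc (n + 1)
  have h3 : (closureCount (n + 1) : ℝ) ≠ 0 := by exact_mod_cast (closureCount_succ_pos n).ne'
  simp only [Pi.div_apply]
  generalize coeff n (sqrtSeries rho⁻¹) = b at h1 ⊢
  generalize coeff (n + 1) (sqrtSeries rho⁻¹) = b' at h2 ⊢
  field_simp

/-- The generating series of closures, divided by `X`. -/
noncomputable def shiftedClosSeries : ℝ⟦X⟧ := PowerSeries.mk fun n => (closureCount (n + 1) : ℝ)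

/-- The series `X / L`, expressed through `L` by means of the quadratic equation. -/
noncomputable def quotientFactor : ℝ⟦X⟧ := (1 - X) * (1 - X) - X * (1 - X) * termSeries

theorem termSeries_mul_quotientFactor : termSeries * quotientFactor = X := by
  rw [quotientFactor]
  linear_combination termSeries_eq

theorem envSeries_eq_mul : envSeries = quotientFactor * shiftedClosSeries := by
  have h : closSeries = X * shiftedClosSeries := by
    ext n
    cases n with
    | zero => simp [coeff_closSeries, closureCount_zero]
    | succ n => rw [coeff_succ_X_mul, coeff_closSeries, shiftedClosSeries, coeff_mk]
  refine mul_left_cancel₀ (X_ne_zero : (X : ℝ⟦X⟧) ≠ 0) ?_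
  linear_combination quotientFactor * h - envSeries * termSeries_mul_quotientFactor
    - quotientFactor * closSeries_eq

theorem absSummableAt_quotientFactor {x : ℝ} (h : AbsSummableAt termSeries x) :
    AbsSummableAt quotientFactor x := by
  have h1 := (absSummableAt_one x).sub (absSummableAt_X x)
  exact (h1.mul h1).sub (((absSummableAt_X x).mul h1).mul h)

theorem evalAt_quotientFactor : evalAt quotientFactor rho = 4 * rho := by
  have hL := absSummableAt_termSeries_rho
  have h := congrArg (fun f => evalAt f rho) termSeries_mul_quotientFactor
  rw [evalAt_mul hL (absSummableAt_quotientFactor hL), evalAt_termSeries_rho, evalAt_X] at h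
  linarith

theorem tendsto_envCount :
    Tendsto (fun n : ℕ => (envCount n : ℝ) * rho ^ n * (n : ℝ) ^ (3 / 2 : ℝ)) atTop
      (𝓝 (evalAt regularFactor rho / √Real.pi)) := by
  have hpos : ∀ n, (closureCount (n + 1) : ℝ) ≠ 0 := fun n => by
    exact_mod_cast (closureCount_succ_pos n).ne'
  have hcoeff : ∀ n, coeff n shiftedClosSeries = closureCount (n + 1) := fun n => coeff_mk _ _
  have h1 := tendsto_coeff_mul_div (f := shiftedClosSeries) (g := quotientFactor) (ρ := rho)
    (r := 1 / 5) (fun n => by rw [hcoeff]; exact hpos n)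
    (by simpa only [hcoeff] using (tendsto_add_atTop_iff_nat 1).2 tendsto_closureCount_ratio)
    rho_pos.le (by linarith [rho_bounds.2])
    (absSummableAt_quotientFactor absSummableAt_termSeries)
  rw [evalAt_quotientFactor, ← envSeries_eq_mul] at h1
  simp only [hcoeff, envSeries, coeff_mk] at h1
  have h2 := (h1.div tendsto_closureCount_ratio rho_pos.ne').mul tendsto_closureCount
  have e : 4 * rho / rho * (evalAt regularFactor rho / (4 * √Real.pi)) =
      evalAt regularFactor rho / √Real.pi := by
    have : √Real.pi ≠ 0 := (Real.sqrt_pos.2 Real.pi_pos).ne'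
    have := rho_pos.ne'
    field_simp
  rw [e] at h2
  refine h2.congr' ?_
  filter_upwards [eventually_ge_atTop 1] with n hn
  obtain ⟨m, rfl⟩ := Nat.exists_eq_add_of_le' hn
  have h3 := hpos m
  have h4 := hpos (m + 1)
  simp only [Pi.div_apply]
  field_simp

/-! ### The constants -/

theorem evalAt_regularFactor_sq_eq :
    evalAt regularFactor rho ^ 2 = 5 * (109 + 35 * √545) / 3008 := by
  have h := evalAt_regularFactor_sq
  have hw : √545 ^ 2 = 545 := Real.sq_sqrt (by norm_num)
  have hb := rho_bounds
  have hne : (1 - rho) * (4 - 6 * rho) ≠ 0 := by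
    refine (mul_pos ?_ ?_).ne' <;> linarith
  refine mul_right_cancel₀ hne ?_
  rw [h]
  have hρ : rho = (25 - √545) / 10 := by
    unfold rho
    ring
  rw [hρ]
  linear_combination (-(5 / 100) - (5 / 300800) * (210 * √545 - 6346)) * hw

theorem constEnv_eq : constEnv = evalAt regularFactor rho / √Real.pi := by
  have hg := evalAt_regularFactor_pos
  have h : (5 / 47) * (109 + 35 * √545) = (8 * evalAt regularFactor rho) ^ 2 := by
    rw [mul_pow, evalAt_regularFactor_sq_eq]
    ring
  rw [constEnv, h, Real.sqrt_sq (by positivity)]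
  have : √Real.pi ≠ 0 := (Real.sqrt_pos.2 Real.pi_pos).ne'
  field_simp

theorem constClos_eq : constClos = evalAt regularFactor rho / (4 * √Real.pi) := by
  have hg := evalAt_regularFactor_pos
  have hb := sqrt_545_bounds
  have hw : √545 ^ 2 = 545 := Real.sq_sqrt (by norm_num)
  have hp : √5 ^ 2 = 5 := Real.sq_sqrt (by norm_num)
  have hq : √109 ^ 2 = 109 := Real.sq_sqrt (by norm_num)
  have hpq : √545 = √5 * √109 := by
    rw [← Real.sqrt_mul (by norm_num)]
    norm_num
  have hp0 : 0 < √5 := Real.sqrt_pos.2 (by norm_num)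
  have hden : 65 * √109 - 301 * √5 ≠ 0 := by
    intro h
    have : 65 * √545 - 1505 = 0 := by linear_combination √5 * h + 65 * hpq + 301 * hp
    linarith
  have h77 : 0 < 77 - 3 * √545 := by linarith
  have h : (10 * (48069 * √5 - 10295 * √109)) / (65 * √109 - 301 * √5) =
      (evalAt regularFactor rho / 4 * (77 - 3 * √545)) ^ 2 := by
    rw [div_eq_iff hden, mul_pow, div_pow, evalAt_regularFactor_sq_eq]
    have e1 : (109 + 35 * √545) * (77 - 3 * √545) ^ 2 = -7631744 + 328832 * √545 := by
      linear_combination (-15189 + 315 * √545) * hw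
    have e2 : √545 * √109 = 109 * √5 := by
      rw [hpq]
      linear_combination √5 * hq
    have e3 : √545 * √5 = 5 * √109 := by
      rw [hpq]
      linear_combination √109 * hp
    linear_combination -(5 / 48128) * (65 * √109 - 301 * √5) * e1
      - (5 / 48128) * 328832 * 65 * e2 + (5 / 48128) * 328832 * 301 * e3
  rw [constClos, h, Real.sqrt_sq (by positivity)]
  have : √Real.pi ≠ 0 := (Real.sqrt_pos.2 Real.pi_pos).ne'
  field_simp

theorem constEnv_bounds : 0.6999965 < constEnv ∧ constEnv < 0.6999975 := by
  have hb := sqrt_545_bounds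
  have h : constEnv = √(5 * (109 + 35 * √545) / 3008 / Real.pi) := by
    rw [constEnv_eq, ← evalAt_regularFactor_sq_eq, Real.sqrt_div (by positivity),
      Real.sqrt_sq evalAt_regularFactor_pos.le]
  have h1 := Real.pi_gt_d20
  have h2 := Real.pi_lt_d20
  rw [h]
  constructor
  · rw [Real.lt_sqrt (by norm_num), lt_div_iff₀ Real.pi_pos]
    linarith
  · rw [Real.sqrt_lt' (by norm_num), div_lt_iff₀ Real.pi_pos]
    linarith

/-! ### The roots of `1 - 4 L` -/

theorem summable_and_one_sub_four_termGF_eq_zero_iff (z : ℂ) :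
    (Summable (fun n : ℕ => (termCount n : ℂ) * z ^ n) ∧ 1 - 4 * termGF z = 0) ↔
      z = (rho : ℂ) := by
  constructor
  · rintro ⟨hsum, hz⟩
    -- convergence forces `‖z‖ < 1`, and the quadratic equation with `L = 1 / 4` leaves only `rho`
    -- and its conjugate `5 - rho`
    set f : ℂ⟦X⟧ := PowerSeries.map Complex.ofRealHom termSeries with hfdef
    have hcoeff : ∀ n, coeff n f = termCount n := fun n => by
      simp [hfdef, coeff_map, coeff_termSeries]
    have hf : (1 - X) * f = X + X * (1 - X) * (f + f ^ 2) := by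
      have := congrArg (PowerSeries.map Complex.ofRealHom) termSeries_eq
      simpa only [map_mul, map_add, map_sub, map_one, map_pow, PowerSeries.map_X] using this
    have habs : AbsSummableAt f z := by
      simpa only [AbsSummableAt, hcoeff] using hsum.norm
    have heval : evalAt f z = 1 / 4 := by
      have : evalAt f z = termGF z := by simp only [evalAt, hcoeff, termGF]
      rw [this]
      linear_combination -(1 / 4) * hz
    have hnorm : ‖z‖ < 1 := by
      have h1 : Summable fun n : ℕ => ‖z‖ ^ (n + 1) := by
        refine Summable.of_nonneg_of_le (fun n => by positivity) (fun n => ?_)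
          ((summable_nat_add_iff 1).2 hsum.norm)
        rw [norm_mul, norm_pow, Complex.norm_natCast]
        have : (1 : ℝ) ≤ termCount (n + 1) := by exact_mod_cast one_le_termCount_succ n
        exact le_mul_of_one_le_left (by positivity) this
      have h2 : Summable fun n : ℕ => ‖z‖ ^ n :=
        (summable_nat_add_iff (f := fun n : ℕ => ‖z‖ ^ n) 1).1 h1
      simpa only [norm_norm] using summable_geometric_iff_norm_lt_one.1 h2
    have hq := eval_quadratic hf habs
    rw [heval] at hq
    have hr : (5 * (rho : ℂ) ^ 2 - 25 * rho + 4 : ℂ) = 0 := by exact_mod_cast rho_quadratic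
    have hfac : (z - rho) * (z - (5 - rho)) = 0 := by
      linear_combination (16 / 5) * hq - hr / 5
    rcases mul_eq_zero.1 hfac with h | h
    · exact sub_eq_zero.1 h
    · exfalso
      have h' : z = ((5 - rho : ℝ) : ℂ) := by
        push_cast
        exact sub_eq_zero.1 h
      rw [h', Complex.norm_real, Real.norm_eq_abs, abs_lt] at hnorm
      linarith [rho_bounds.2]
  · rintro rfl
    have hs : Summable fun n : ℕ => (termCount n : ℝ) * rho ^ n := by
      simpa only [coeff_termSeries] using Summable.of_norm absSummableAt_termSeries_rho
    have hcast : (fun n : ℕ => (termCount n : ℂ) * (rho : ℂ) ^ n) =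
        fun n : ℕ => (((termCount n : ℝ) * rho ^ n : ℝ) : ℂ) := by
      ext n
      push_cast
      rfl
    constructor
    · rw [hcast]
      exact Complex.summable_ofReal.2 hs
    · have h := evalAt_termSeries_rho
      simp only [evalAt, coeff_termSeries] at h
      rw [termGF, hcast, ← Complex.ofReal_tsum, h]
      norm_num

/-- A limit of normalized counts, restated as an asymptotic equivalence. -/
theorem isEquivalent_of_tendsto_mul {u : ℕ → ℝ} {K ρ : ℝ} (hK : K ≠ 0) (hρ : 0 < ρ)
    (h : Tendsto (fun n : ℕ => u n * ρ ^ n * (n : ℝ) ^ (3 / 2 : ℝ)) atTop (𝓝 K)) :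
    Asymptotics.IsEquivalent atTop u
      (fun n : ℕ => K * ρ ^ (-(n : ℤ)) * (n : ℝ) ^ (-(3 / 2) : ℝ)) := by
  have hv : ∀ᶠ n : ℕ in atTop, K * ρ ^ (-(n : ℤ)) * (n : ℝ) ^ (-(3 / 2) : ℝ) ≠ 0 := by
    filter_upwards [eventually_ge_atTop 1] with n hn
    have hn0 : (0 : ℝ) < n := by exact_mod_cast hn
    exact mul_ne_zero (mul_ne_zero hK (zpow_ne_zero _ hρ.ne')) (Real.rpow_pos_of_pos hn0 _).ne'
  rw [Asymptotics.isEquivalent_iff_tendsto_one hv]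
  have h1 := h.div_const K
  rw [div_self hK] at h1
  refine h1.congr' ?_
  filter_upwards [eventually_ge_atTop 1] with n hn
  have hn0 : (0 : ℝ) < n := by exact_mod_cast hn
  have := (Real.rpow_pos_of_pos hn0 (3 / 2)).ne'
  simp only [Pi.div_apply]
  rw [zpow_neg, zpow_natCast, Real.rpow_neg hn0.le]
  field_simp

end PlainClosures

theorem mainTheorem1 :
    -- there are only finitely many objects of each size
    ((∀ n : ℕ, (PlainClosures.termsOfSize n).Finite) ∧
      (∀ n : ℕ, (PlainClosures.envsOfSize n).Finite) ∧
      (∀ n : ℕ, (PlainClosures.closuresOfSize n).Finite)) ∧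
    -- the asymptotic numbers of environments and of closures
    Asymptotics.IsEquivalent Filter.atTop
      (fun n : ℕ => (PlainClosures.envCount n : ℝ))
      (fun n : ℕ => PlainClosures.constEnv * PlainClosures.rho ^ (-(n : ℤ)) *
        (n : ℝ) ^ (-(3 / 2) : ℝ)) ∧
    Asymptotics.IsEquivalent Filter.atTop
      (fun n : ℕ => (PlainClosures.closureCount n : ℝ))
      (fun n : ℕ => PlainClosures.constClos * PlainClosures.rho ^ (-(n : ℤ)) *
        (n : ℝ) ^ (-(3 / 2) : ℝ)) ∧
    -- the growth parameter is the only root of `1 - 4 L(z) = 0` where the series `L` converges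
    (∀ z : ℂ, (Summable (fun n : ℕ => (PlainClosures.termCount n : ℂ) * z ^ n) ∧
        1 - 4 * PlainClosures.termGF z = 0) ↔ z = (PlainClosures.rho : ℂ)) ∧
    -- the numerical values, correct to the last digit displayed
    |PlainClosures.rho - 0.165476| < 0.0000005 ∧
    |PlainClosures.rho⁻¹ - 6.04315| < 0.000005 ∧
    |PlainClosures.constEnv - 0.699997| < 0.0000005 ∧
    |PlainClosures.constClos - 0.174999| < 0.0000005 := by
  have henv := PlainClosures.constEnv_bounds
  have hrho := PlainClosures.rho_bounds
  have hpos := PlainClosures.rho_pos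
  have hclos : PlainClosures.constClos = PlainClosures.constEnv / 4 := by
    rw [PlainClosures.constClos_eq, PlainClosures.constEnv_eq, div_div, mul_comm 4]
  refine ⟨⟨PlainClosures.termsOfSize_finite, PlainClosures.envsOfSize_finite,
    PlainClosures.closuresOfSize_finite⟩, ?_, ?_,
    PlainClosures.summable_and_one_sub_four_termGF_eq_zero_iff, ?_, ?_, ?_, ?_⟩
  · refine PlainClosures.isEquivalent_of_tendsto_mul (by linarith) hpos ?_
    rw [PlainClosures.constEnv_eq]
    exact PlainClosures.tendsto_envCount
  · refine PlainClosures.isEquivalent_of_tendsto_mul (by linarith) hpos ?_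
    rw [PlainClosures.constClos_eq]
    exact PlainClosures.tendsto_closureCount
  · rw [abs_lt]
    constructor <;> linarith
  · have h1 : PlainClosures.rho⁻¹ < 6.043155 := by
      rw [inv_lt_comm₀ hpos (by norm_num)]
      refine lt_trans ?_ hrho.1
      norm_num
    have h2 : 6.043145 < PlainClosures.rho⁻¹ := by
      rw [lt_inv_comm₀ (by norm_num) hpos]
      refine hrho.2.trans ?_
      norm_num
    rw [abs_lt]
    constructor <;> linarith
  · rw [abs_lt]
    constructor <;> linarith
  · rw [hclos, abs_lt]
    constructor <;> linarith
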